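/- For each integer $N\ge 1$, on some probability space, let $U=U^{(N)}$ be a random unitary $N\times N$ matrix and $v=v^{(N)}\in\mathbb C^N$ a random unit vector. For real $t$ put $G(t)=U\,(I_N-(1-t)vv^*)$, and set $$\omega_1=\omega_1^{(N)}=\sqrt N\,v^*U^*v,\qquad \mathscr W_2(z)=v^*\,(zU^*)^2(I_N-zU^*)^{-1}\,v\quad(|z|<1),\qquad z_t=\frac{\sqrt N}{\omega_1}\,\frac{t}{1-t}.$$ Write $D(a,r)=\{z\in\mathbb C:|z-a|<r\}$ and $\overline{\mathbb D}=\{z\in\mathbb C:|z|\le 1\}$. A sequence of events $E^{(N)}$ holds with high probability if $\mathbb P(E^{(N)})\to1$, and with overwhelming probability if for every $A>0$ one has $1-\mathbb P(E^{(N)})<N^{-A}$ for all large $N$. Eigenvalues are counted with algebraic multiplicity. Assume: (Regularity for $\mathscr W_2$) For all $\delta>0$ and $\eta>0$, with overwhelming probability, $$|\mathscr W_2(z)|\le N^{\eta}\,\frac{|z|^2}{\sqrt N\,(1-|z|)}\qquad\text{for all } z\in D(0,1-N^{-\delta}).$$ (Regularity for $\omega_1$) For all $\eta>0$, with high probability,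 $N^{-\eta}<|\omega_1^{(N)}|<N^{\eta}$. **Theorem.** For any $\alpha>\varepsilon>0$, with high probability the following hold simultaneously. (i) For every real $t\neq0$ with $|t|<N^{-1/2-\alpha}$, exactly one eigenvalue of $G(t)$ lies in $D\big(z_t,|z_t|^2N^{\varepsilon}\big)$, and all other eigenvalues lie in $\overline{\mathbb D}\setminus D(0,N^{-\varepsilon})$. For $t=0$ the same holds with the disc $D\big(z_t,|z_t|^2N^{\varepsilon}\big)$ replaced by its center: $z_0=0$ is a simple eigenvalue of $G(0)$, and all other eigenvalues lie in $\overline{\mathbb D}\setminus D(0,N^{-\varepsilon})$. (ii) For every $t\in(-1,1)$ with $|t|>N^{-1/2+\alpha}$, all eigenvalues of $G(t)$ lie in $\overline{\mathbb D}\setminus D\big(0,\,1-|z_t|^{-1}N^{\varepsilon}\big)$. -/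

import Mathlib

open Filter Topology MeasureTheory

noncomputable section

namespace UAModel

/-- The rank-one multiplicative perturbation `G(t) = U (I - (1 - t) v v^*)`. -/
def G {N : ℕ} (U : Matrix (Fin N) (Fin N) ℂ) (v : EuclideanSpace ℂ (Fin N)) (t : ℝ) :
    Matrix (Fin N) (Fin N) ℂ :=
  U * (1 - (1 - (t : ℂ)) • Matrix.vecMulVec v.ofLp (star v.ofLp))

/-- The eigenvalues of a complex square matrix, repeated according to algebraic multiplicity. -/
def eigenvalues {N : ℕ} (M : Matrix (Fin N) (Fin N) ℂ) : Multiset ℂ :=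
  M.charpoly.roots

/-- `ω₁ = √N v^* U^* v`. -/
def omega1 {N : ℕ} (U : Matrix (Fin N) (Fin N) ℂ) (v : EuclideanSpace ℂ (Fin N)) : ℂ :=
  (Real.sqrt N : ℂ) * (star v.ofLp ⬝ᵥ (star U).mulVec v.ofLp)

/-- `W₂(z) = v^* (z U^*)^2 (I - z U^*)⁻¹ v`, used for `|z| < 1`, where the inverse exists. -/
def W2 {N : ℕ} (U : Matrix (Fin N) (Fin N) ℂ) (v : EuclideanSpace ℂ (Fin N)) (z : ℂ) : ℂ :=
  star v.ofLp ⬝ᵥ ((z • star U) ^ 2 * (1 - z • star U)⁻¹).mulVec v.ofLp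

/-- `z_t = (√N / ω₁) (t / (1 - t))`. -/
def zt {N : ℕ} (U : Matrix (Fin N) (Fin N) ℂ) (v : EuclideanSpace ℂ (Fin N)) (t : ℝ) : ℂ :=
  (Real.sqrt N : ℂ) / omega1 U v * ((t : ℂ) / (1 - (t : ℂ)))

open Classical in
/-- Exactly one eigenvalue of `M` (counted with algebraic multiplicity) lies in `S`, and all the
other eigenvalues lie in the closed unit disc, outside `T`. -/
def ExactlyOneIn {N : ℕ} (M : Matrix (Fin N) (Fin N) ℂ) (S T : Set ℂ) : Prop :=
  (eigenvalues M).countP (fun μ => μ ∈ S) = 1 ∧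
    ∀ μ ∈ eigenvalues M, μ ∉ S → μ ∈ Metric.closedBall (0 : ℂ) 1 \ T

section Probability

variable {Ω : ℕ → Type*} [∀ N, MeasurableSpace (Ω N)]

/-- The events `E N` hold with high probability: `P(E N) → 1`. This is expressed through the
(outer) measure of the complement, so that it is also meaningful, and not weaker, for events
whose measurability is not obvious. -/
def WHP (P : ∀ N, Measure (Ω N)) (E : ∀ N, Set (Ω N)) : Prop :=
  Tendsto (fun N => P N (E N)ᶜ) atTop (𝓝 0)

/-- The events `E N` hold with overwhelming probability: for every `A > 0`,
`1 - P(E N) < N ^ (-A)` for large enough `N`. -/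
def WOP (P : ∀ N, Measure (Ω N)) (E : ∀ N, Set (Ω N)) : Prop :=
  ∀ A : ℝ, 0 < A → ∀ᶠ N : ℕ in atTop, P N (E N)ᶜ < ENNReal.ofReal ((N : ℝ) ^ (-A))

/-- Stochastic domination `X ≺ Y`, uniformly for `z ∈ S N`. -/
def StochDom (P : ∀ N, Measure (Ω N)) (X Y : ∀ N, ℂ → Ω N → ℂ) (S : ℕ → Set ℂ) : Prop :=
  ∀ ε : ℝ, 0 < ε →
    WOP P (fun N => {ω | ∀ z ∈ S N, ‖X N z ω‖ ≤ (N : ℝ) ^ ε * ‖Y N z ω‖})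

/-- Regularity for `W₂`: for any `δ > 0`, `W₂(z) ≺ |z|² / (√N (1 - |z|))`, uniformly for
`|z| < 1 - N ^ (-δ)`. -/
def RegularityW2 (P : ∀ N, Measure (Ω N)) (U : ∀ N, Ω N → Matrix (Fin N) (Fin N) ℂ)
    (v : ∀ N, Ω N → EuclideanSpace ℂ (Fin N)) : Prop :=
  ∀ δ : ℝ, 0 < δ →
    StochDom P (fun N z ω => W2 (U N ω) (v N ω) z)
      (fun N z _ => ((‖z‖ ^ 2 / (Real.sqrt N * (1 - ‖z‖)) : ℝ) : ℂ))
      (fun N => Metric.ball (0 : ℂ) (1 - (N : ℝ) ^ (-δ)))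

/-- Regularity for `ω₁`: for any `ε > 0`, `N ^ ε > |ω₁| > N ^ (-ε)` with high probability. -/
def RegularityOmega1 (P : ∀ N, Measure (Ω N)) (U : ∀ N, Ω N → Matrix (Fin N) (Fin N) ℂ)
    (v : ∀ N, Ω N → EuclideanSpace ℂ (Fin N)) : Prop :=
  ∀ ε : ℝ, 0 < ε →
    WHP P (fun N => {ω | (N : ℝ) ^ (-ε) < ‖omega1 (U N ω) (v N ω)‖ ∧
      ‖omega1 (U N ω) (v N ω)‖ < (N : ℝ) ^ ε})

end Probability

end UAModel

end

/-! Since `z - U = -U (1 - z U^*)`, the matrix determinant lemma gives, for `|z| < 1`, `det (z -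
G(t)) = det (z - U) * (1 - (1 - t) v^* (1 - z U^*)⁻¹ v)`, with a nonvanishing first factor.
Expanding the resolvent to second order turns the eigenvalue equation into `z + h(z) = z_t`, with `h
= (√N / ω₁) W₂` independent of `t` (`mem_eigenvalues_G_iff`). Bounds on `h` thus serve all `t` on a
single event.

For small `z_t`, the bound `|h(z)| ≤ 4 A² |z|²`, `A = N^η`, makes `z ↦ z_t - h(z)` a contraction
near `0`. Its fixed point is a simple eigenvalue within `O(A² |z_t|²)` of `z_t`
(`exists_unique_simple_solution`).

For large `z_t`, a solution needs `|h(z)| ≥ |z_t| - 1`, whereas `(1 - |z|) |h(z)| ≤ 17 A²`; hence `1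
- |z|` is at most of order `A² / |z_t|`. As `t → 1` this scale drops below every power of `N`, where
the regularity of `W₂` says nothing. The bound is carried to the unit circle by
`one_sub_mul_norm_inner_resolvent_le`, which uses only unitarity. -/

namespace UAModel

/-! ### Resolvents of isometries along a radius -/

section Resolvent

variable {E : Type*} [NormedAddCommGroup E] [InnerProductSpace ℂ E]

/-- Expand `‖z S x‖ = ‖x - v‖`. The real part of the quadratic form thus controls the whole
resolvent vector. -/
lemma norm_sq_mul_of_sub_smul_eq {S : E →ₗ[ℂ] E} (hS : ∀ x, ‖S x‖ = ‖x‖) {z : ℂ} {x v : E}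
    (hx : x - z • S x = v) :
    ‖x‖ ^ 2 * (1 - ‖z‖ ^ 2) = 2 * (inner ℂ v x).re - ‖v‖ ^ 2 := by
  have h1 : ‖z • S x‖ = ‖x - v‖ := by rw [← hx]; simp
  have h2 := norm_sub_sq (𝕜 := ℂ) x v
  rw [← h1, norm_smul, hS, ← inner_conj_symm] at h2
  simp only [RCLike.re_to_complex, Complex.conj_re] at h2
  linarith

/-- The resolvent of an isometry along a radius: `(1 - |z|) |⟨v, (1 - z S)⁻¹ v⟩|` is nonincreasing
in `|z|` up to a factor `3`. -/
lemma one_sub_mul_norm_inner_resolvent_le {S S' : E →ₗ[ℂ] E} (hS : ∀ x, ‖S x‖ = ‖x‖)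
    (hS' : ∀ x, ‖S' x‖ = ‖x‖) (hadj : ∀ x y, inner ℂ (S' x) y = inner ℂ x (S y))
    {z z₀ : ℂ} {x x₀ y₀ v : E} (hx : x - z • S x = v) (hx₀ : x₀ - z₀ • S x₀ = v)
    (hy₀ : y₀ - (starRingEnd ℂ z₀) • S' y₀ = v) (hle : ‖z₀‖ ≤ ‖z‖) (hz : ‖z‖ < 1)
    (hrad : ‖z - z₀‖ = ‖z‖ - ‖z₀‖) :
    (1 - ‖z‖) * ‖inner ℂ v x‖ ≤ 3 * ((1 - ‖z₀‖) * ‖inner ℂ v x₀‖) := by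
  have hpair : ∀ w : E, inner ℂ v w = inner ℂ y₀ (w - z₀ • S w) := by
    intro w
    rw [← hy₀, inner_sub_left, inner_smul_left, hadj, inner_sub_right, inner_smul_right]
    simp
  have hy₀v : inner ℂ y₀ v = inner ℂ v x₀ := by rw [hpair x₀, hx₀]
  -- The resolvent identity, with `y₀` the resolvent vector of the adjoint.
  have hxx : inner ℂ v x = inner ℂ v x₀ + (z - z₀) * inner ℂ y₀ (S x) := by
    rw [← hy₀v, hpair x, ← inner_smul_right, ← inner_add_right, ← hx]
    congr 1
    module
  have hX := norm_sq_mul_of_sub_smul_eq hS hx₀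
  have hY := norm_sq_mul_of_sub_smul_eq hS' hy₀
  have hre : (inner ℂ v y₀).re = (inner ℂ v x₀).re := by
    rw [← hy₀v, ← inner_conj_symm v y₀, Complex.conj_re]
  have hs₀ : 0 < 1 - ‖z₀‖ := by linarith
  have hs : 0 < 1 - ‖z‖ := by linarith
  have hsq : 0 < 1 - ‖z₀‖ ^ 2 := by nlinarith [norm_nonneg z₀]
  -- Both norms are determined by the same real part.
  have hYX : ‖y₀‖ = ‖x₀‖ := by
    rw [hre, Complex.norm_conj, ← hX] at hY
    exact (pow_left_inj₀ (norm_nonneg _) (norm_nonneg _) two_ne_zero).1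
      (mul_right_cancel₀ hsq.ne' hY)
  have hW : ‖x₀‖ ^ 2 * (1 - ‖z₀‖) ≤ 2 * ‖inner ℂ v x₀‖ := by
    have h1 := Complex.re_le_norm (inner ℂ v x₀)
    have h2 : ‖x₀‖ ^ 2 * (1 - ‖z₀‖) ≤ ‖x₀‖ ^ 2 * (1 - ‖z₀‖ ^ 2) := by
      gcongr
      nlinarith [norm_nonneg z₀]
    nlinarith [sq_nonneg ‖v‖]
  -- From `x - x₀ = z S (x - x₀) + (z - z₀) S x₀`; on a radius `|z - z₀| = |z| - |z₀|`.
  have hxn : (1 - ‖z‖) * ‖x‖ ≤ (1 - ‖z₀‖) * ‖x₀‖ := by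
    have h1 : x = x₀ + (z • S (x - x₀) + (z - z₀) • S x₀) := by
      have : x = x₀ + ((v + z • S x) - (v + z₀ • S x₀)) + (x - z • S x - v)
          - (x₀ - z₀ • S x₀ - v) := by module
      rw [hx, hx₀] at this
      rw [map_sub]
      calc x = _ := this
        _ = _ := by module
    have h2 : ‖x - x₀‖ ≤ ‖z‖ * ‖x - x₀‖ + (‖z‖ - ‖z₀‖) * ‖x₀‖ := by
      calc ‖x - x₀‖ = ‖z • S (x - x₀) + (z - z₀) • S x₀‖ := by
            conv_lhs => rw [h1]
            rw [add_sub_cancel_left]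
        _ ≤ _ := norm_add_le _ _
        _ = _ := by rw [norm_smul, norm_smul, hS, hS, hrad]
    have h3 : ‖x‖ ≤ ‖x₀‖ + ‖x - x₀‖ := by
      simpa using norm_add_le x₀ (x - x₀)
    nlinarith
  have hfin : ‖inner ℂ v x‖ ≤ ‖inner ℂ v x₀‖ + (‖z‖ - ‖z₀‖) * (‖x₀‖ * ‖x‖) := by
    rw [hxx]
    refine (norm_add_le _ _).trans ?_
    rw [norm_mul, hrad]
    gcongr
    calc _ ≤ _ := norm_inner_le_norm _ _
      _ = _ := by rw [hS, hYX]
  calc (1 - ‖z‖) * ‖inner ℂ v x‖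
      ≤ (1 - ‖z‖) * ‖inner ℂ v x₀‖ + (‖z‖ - ‖z₀‖) * (‖x₀‖ * ((1 - ‖z‖) * ‖x‖)) := by
        nlinarith
    _ ≤ (1 - ‖z₀‖) * ‖inner ℂ v x₀‖ + (1 - ‖z₀‖) * (‖x₀‖ * ((1 - ‖z₀‖) * ‖x₀‖)) := by
        gcongr
    _ = (1 - ‖z₀‖) * (‖inner ℂ v x₀‖ + ‖x₀‖ ^ 2 * (1 - ‖z₀‖)) := by ring
    _ ≤ (1 - ‖z₀‖) * (‖inner ℂ v x₀‖ + 2 * ‖inner ℂ v x₀‖) := by gcongr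
    _ = _ := by ring

end Resolvent

/-! ### Simple zeros of holomorphic perturbations -/

/-- A holomorphic perturbation of the identity, of second order at the origin, takes each small
value exactly once near the origin, and to first order. -/
lemma exists_unique_simple_solution {h : ℂ → ℂ} {L R : ℝ} (hL : 0 < L) (hR : 0 < R)
    (hR4 : R ≤ 1 / 4) (hLR : L * R ≤ 1 / 100)
    (hd : DifferentiableOn ℂ h (Metric.ball 0 (3 / 4)))
    (hb : ∀ z, ‖z‖ < 3 / 4 → ‖h z‖ ≤ L * ‖z‖ ^ 2) {a : ℂ} (ha : ‖a‖ ≤ R / 100) :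
    ∃ z, ‖z‖ < R ∧ z + h z = a ∧ ‖z - a‖ ≤ 4 * L * ‖a‖ ^ 2 ∧ 1 + deriv h z ≠ 0 ∧
      ∀ w, ‖w‖ < R → w + h w = a → w = z := by
  have hda : ∀ z ∈ Metric.closedBall (0 : ℂ) R, DifferentiableAt ℂ h z := by
    intro z hz
    rw [mem_closedBall_zero_iff] at hz
    exact hd.differentiableAt (Metric.isOpen_ball.mem_nhds (by
      rw [mem_ball_zero_iff]; linarith))
  have hderiv : ∀ z ∈ Metric.closedBall (0 : ℂ) R, ‖deriv h z‖ ≤ 1 / 2 := by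
    intro z hz
    rw [mem_closedBall_zero_iff] at hz
    -- Cauchy's estimate on the circle of radius `R` about `z`, which stays in `|w| ≤ 2R ≤ 1/2`.
    have key : ‖deriv h z‖ ≤ L * (2 * R) ^ 2 / R := by
      refine Complex.norm_deriv_le_of_forall_mem_sphere_norm_le hR ?_ ?_
      · refine DifferentiableOn.diffContOnCl ?_
        rw [closure_ball z hR.ne']
        refine hd.mono fun w hw => ?_
        rw [mem_closedBall_iff_norm] at hw
        rw [mem_ball_zero_iff]
        have := norm_add_le (w - z) z
        rw [sub_add_cancel] at this
        linarith
      · intro w hw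
        rw [mem_sphere_iff_norm] at hw
        have := norm_add_le (w - z) z
        rw [sub_add_cancel] at this
        refine (hb w (by linarith)).trans ?_
        gcongr
        linarith
    refine key.trans ?_
    rw [div_le_iff₀ hR]
    nlinarith
  have hlip : LipschitzOnWith (1 / 2) h (Metric.closedBall (0 : ℂ) R) :=
    (convex_closedBall (0 : ℂ) R).lipschitzOnWith_of_nnnorm_deriv_le hda fun z hz => by
      rw [← NNReal.coe_le_coe]
      simpa using hderiv z hz
  have huniq : ∀ w z, ‖w‖ ≤ R → ‖z‖ ≤ R → w + h w = a → z + h z = a → w = z := by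
    intro w z hw hz hwa hza
    have h1 := hlip.norm_sub_le (mem_closedBall_zero_iff.2 hw) (mem_closedBall_zero_iff.2 hz)
    have h2 : h w - h z = -(w - z) := by linear_combination hwa - hza
    rw [h2, norm_neg] at h1
    have h3 : ‖w - z‖ ≤ 0 := by
      have : ((1 / 2 : NNReal) : ℝ) = 1 / 2 := by norm_num
      rw [this] at h1
      linarith
    exact sub_eq_zero.1 (norm_le_zero_iff.1 h3)
  have hmaps : Set.MapsTo (fun z => a - h z) (Metric.closedBall (0 : ℂ) R)
      (Metric.closedBall (0 : ℂ) R) := by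
    intro z hz
    rw [mem_closedBall_zero_iff] at hz ⊢
    have h1 := hb z (by linarith)
    have h2 := norm_sub_le a (h z)
    have h3 : L * ‖z‖ ^ 2 ≤ L * R ^ 2 := by gcongr
    nlinarith
  have hcontr : ContractingWith (1 / 2) (hmaps.restrict _ _ _) := by
    refine ⟨by norm_num, ?_⟩
    refine LipschitzWith.of_dist_le_mul fun x y => ?_
    rw [Subtype.dist_eq, Set.MapsTo.val_restrict_apply, Set.MapsTo.val_restrict_apply,
      dist_sub_left]
    exact hlip.dist_le_mul _ x.2 _ y.2
  obtain ⟨z, hz, hfix, -, -⟩ := hcontr.exists_fixedPoint'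
    (x := 0) Metric.isClosed_closedBall.isComplete hmaps (by simp [hR.le]) (edist_ne_top _ _)
  have hza : z + h z = a := by
    have : a - h z = z := hfix
    linear_combination -this
  rw [mem_closedBall_zero_iff] at hz
  have hhz := hb z (by linarith)
  have hz2 : ‖z‖ ≤ 2 * ‖a‖ := by
    have h1 : z = a - h z := by linear_combination hza
    have h2 : ‖z‖ ≤ ‖a‖ + ‖h z‖ := by
      conv_lhs => rw [h1]
      exact norm_sub_le _ _
    have h3 : L * ‖z‖ ^ 2 ≤ 1 / 100 * ‖z‖ := by
      calc L * ‖z‖ ^ 2 = (L * ‖z‖) * ‖z‖ := by ring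
        _ ≤ (L * R) * ‖z‖ := by gcongr
        _ ≤ _ := by gcongr
    linarith [norm_nonneg z]
  refine ⟨z, by linarith, hza, ?_, ?_, fun w hw hwa => huniq w z hw.le hz hwa hza⟩
  · have h1 : z - a = -h z := by linear_combination hza
    rw [h1, norm_neg]
    calc ‖h z‖ ≤ L * ‖z‖ ^ 2 := hhz
      _ ≤ L * (2 * ‖a‖) ^ 2 := by gcongr
      _ = _ := by ring
  · intro h0
    have h1 := hderiv z (mem_closedBall_zero_iff.2 hz)
    rw [eq_neg_of_add_eq_zero_right h0, norm_neg, norm_one] at h1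
    norm_num at h1

/-- The factorization is only local and holomorphic, so multiplicity is read off the derivative: `p'
= q F'` where `F` vanishes. -/
lemma count_roots_eq_one_of_eventually_eq {p : Polynomial ℂ} {q F : ℂ → ℂ} {z : ℂ}
    (hp : p ≠ 0) (hq : DifferentiableAt ℂ q z) (hF : DifferentiableAt ℂ F z)
    (heq : ∀ᶠ w in 𝓝 z, p.eval w = q w * F w) (hqz : q z ≠ 0) (hFz : F z = 0)
    (hF' : deriv F z ≠ 0) : p.roots.count z = 1 := by
  have hroot : p.IsRoot z := by
    rw [Polynomial.IsRoot, heq.self_of_nhds, hFz, mul_zero]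
  have hder : p.derivative.eval z = q z * deriv F z := by
    rw [← Polynomial.deriv, Filter.EventuallyEq.deriv_eq (f := fun w => q w * F w) heq,
      deriv_fun_mul hq hF, hFz]
    ring
  rw [Polynomial.count_roots]
  refine le_antisymm ?_ ((Polynomial.rootMultiplicity_pos hp).2 hroot)
  by_contra! h
  have := ((Polynomial.one_lt_rootMultiplicity_iff_isRoot hp).1 h).2
  rw [Polynomial.IsRoot, hder] at this
  exact mul_ne_zero hqz hF' this

/-! ### The characteristic polynomial of the perturbed unitary matrix -/

section Deterministic

open scoped Matrix.Norms.L2Operator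

variable {N : ℕ} {U : Matrix (Fin N) (Fin N) ℂ} {v : EuclideanSpace ℂ (Fin N)}

/-- The quadratic form `v^* (I - z U^*)⁻¹ v` of the resolvent. -/
noncomputable def resolventForm (U : Matrix (Fin N) (Fin N) ℂ) (v : EuclideanSpace ℂ (Fin N)) (z : ℂ) : ℂ :=
  star v.ofLp ⬝ᵥ (1 - z • star U)⁻¹.mulVec v.ofLp

lemma star_dotProduct_self_eq_one (hv : ‖v‖ = 1) : star v.ofLp ⬝ᵥ v.ofLp = 1 := by
  rw [dotProduct_comm, ← EuclideanSpace.inner_eq_star_dotProduct, inner_self_eq_norm_sq_to_K, hv]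
  simp

lemma toEuclideanLin_norm_of_mem_unitary (hU : U ∈ Matrix.unitaryGroup (Fin N) ℂ)
    (x : EuclideanSpace ℂ (Fin N)) : ‖U.toEuclideanLin x‖ = ‖x‖ := by
  have h : inner ℂ (U.toEuclideanLin x) (U.toEuclideanLin x) = inner ℂ x x := by
    rw [← LinearMap.adjoint_inner_left, ← Matrix.toEuclideanLin_conjTranspose_eq_adjoint]
    congr 1
    rw [Matrix.toLpLin_apply, Matrix.ofLp_toLpLin, Matrix.toLin'_apply, Matrix.mulVec_mulVec,
      ← Matrix.star_eq_conjTranspose, Matrix.mem_unitaryGroup_iff'.1 hU, Matrix.one_mulVec]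
  rw [inner_self_eq_norm_sq_to_K, inner_self_eq_norm_sq_to_K] at h
  have h2 : ‖U.toEuclideanLin x‖ ^ 2 = ‖x‖ ^ 2 := by exact_mod_cast h
  exact (pow_left_inj₀ (norm_nonneg _) (norm_nonneg _) two_ne_zero).1 h2

lemma isUnit_one_sub_smul (hU : U ∈ Matrix.unitaryGroup (Fin N) ℂ) {z : ℂ} (hz : ‖z‖ < 1) :
    IsUnit (1 - z • U) := by
  rcases isEmpty_or_nonempty (Fin N) with h | h
  · exact isUnit_of_subsingleton _
  · refine isUnit_one_sub_of_norm_lt_one ?_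
    rw [norm_smul, CStarRing.norm_of_mem_unitary hU, mul_one]
    exact hz

lemma mul_inv_one_sub_smul (hU : U ∈ Matrix.unitaryGroup (Fin N) ℂ) {z : ℂ} (hz : ‖z‖ < 1) :
    (1 - z • U) * (1 - z • U)⁻¹ = 1 :=
  Matrix.mul_nonsing_inv _ ((Matrix.isUnit_iff_isUnit_det _).1 (isUnit_one_sub_smul hU hz))

lemma exists_sub_smul_eq (hU : U ∈ Matrix.unitaryGroup (Fin N) ℂ) {z : ℂ} (hz : ‖z‖ < 1)
    (v : EuclideanSpace ℂ (Fin N)) :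
    (1 - z • U)⁻¹.toEuclideanLin v - z • U.toEuclideanLin ((1 - z • U)⁻¹.toEuclideanLin v) = v := by
  have h := congrArg (fun M => M.mulVec v.ofLp) (mul_inv_one_sub_smul hU hz)
  simp only [← Matrix.mulVec_mulVec, Matrix.sub_mulVec, Matrix.one_mulVec,
    Matrix.smul_mulVec] at h
  apply (WithLp.ofLp_injective 2)
  simpa [Matrix.ofLp_toLpLin, Matrix.toLin'_apply] using h

lemma inner_toEuclideanLin (M : Matrix (Fin N) (Fin N) ℂ) (v : EuclideanSpace ℂ (Fin N)) :
    inner ℂ v (M.toEuclideanLin v) = star v.ofLp ⬝ᵥ M.mulVec v.ofLp := by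
  rw [EuclideanSpace.inner_eq_star_dotProduct, Matrix.ofLp_toLpLin, Matrix.toLin'_apply, dotProduct_comm]

lemma one_sub_mul_norm_resolventForm_le (hU : U ∈ Matrix.unitaryGroup (Fin N) ℂ)
    {z z₀ : ℂ} (hle : ‖z₀‖ ≤ ‖z‖) (hz : ‖z‖ < 1) (hrad : ‖z - z₀‖ = ‖z‖ - ‖z₀‖) :
    (1 - ‖z‖) * ‖resolventForm U v z‖ ≤ 3 * ((1 - ‖z₀‖) * ‖resolventForm U v z₀‖) := by
  have hU' : star U ∈ Matrix.unitaryGroup (Fin N) ℂ := Unitary.star_mem hU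
  have hz₀ := hle.trans_lt hz
  rw [resolventForm, resolventForm, ← inner_toEuclideanLin, ← inner_toEuclideanLin]
  refine one_sub_mul_norm_inner_resolvent_le (S := (star U).toEuclideanLin)
    (S' := U.toEuclideanLin) (toEuclideanLin_norm_of_mem_unitary hU')
    (toEuclideanLin_norm_of_mem_unitary hU) ?_ (exists_sub_smul_eq hU' hz v)
    (exists_sub_smul_eq hU' hz₀ v)
    (exists_sub_smul_eq hU (z := starRingEnd ℂ z₀) (by simpa using hz₀) v) hle hz hrad
  intro x y
  rw [Matrix.star_eq_conjTranspose, Matrix.toEuclideanLin_conjTranspose_eq_adjoint,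
    LinearMap.adjoint_inner_right]

lemma resolventForm_eq (hU : U ∈ Matrix.unitaryGroup (Fin N) ℂ) (hv : ‖v‖ = 1) (hN : N ≠ 0)
    {z : ℂ} (hz : ‖z‖ < 1) :
    resolventForm U v z = 1 + z * (omega1 U v / Real.sqrt N) + W2 U v z := by
  have hU' : star U ∈ Matrix.unitaryGroup (Fin N) ℂ := Unitary.star_mem hU
  have hs : (Real.sqrt N : ℂ) ≠ 0 := by
    rw [Complex.ofReal_ne_zero, Real.sqrt_ne_zero']
    exact_mod_cast Nat.pos_of_ne_zero hN
  -- Iterating `R = 1 + z U^* R` once more leaves an exact remainder.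
  have hM : (1 - z • star U)⁻¹
      = 1 + z • star U + (z • star U) ^ 2 * (1 - z • star U)⁻¹ := by
    have h := mul_inv_one_sub_smul hU' hz
    set R := (1 - z • star U)⁻¹
    have h1 : R = 1 + z • star U * R := by
      rw [sub_mul, one_mul, sub_eq_iff_eq_add] at h
      exact h
    calc R = 1 + z • star U * R := h1
      _ = 1 + z • star U * (1 + z • star U * R) := by rw [← h1]; exact h1
      _ = _ := by noncomm_ring
  rw [resolventForm, W2, omega1, mul_div_cancel_left₀ _ hs]
  conv_lhs => rw [hM]
  rw [Matrix.add_mulVec, Matrix.add_mulVec, Matrix.one_mulVec, Matrix.smul_mulVec,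
    dotProduct_add, dotProduct_add, dotProduct_smul, star_dotProduct_self_eq_one hv, smul_eq_mul]

/-- With `R = (1 - z U^*)⁻¹` one has `(z - U) R = -U`, so `z - U` factors out of `z - G(t)` and
leaves a rank-one perturbation of the identity. -/
lemma eval_charpoly_G (hU : U ∈ Matrix.unitaryGroup (Fin N) ℂ) (t : ℝ) {z : ℂ} (hz : ‖z‖ < 1) :
    (G U v t).charpoly.eval z = U.charpoly.eval z * (1 - (1 - t) * resolventForm U v z) := by
  have hU' : star U ∈ Matrix.unitaryGroup (Fin N) ℂ := Unitary.star_mem hU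
  have h := mul_inv_one_sub_smul hU' hz
  set R := (1 - z • star U)⁻¹ with hR
  have hUR : (Matrix.scalar (Fin N) z - U) * R = -U := by
    have h1 : Matrix.scalar (Fin N) z - U = -(U * (1 - z • star U)) := by
      rw [mul_sub, mul_smul_comm, Matrix.mem_unitaryGroup_iff.1 hU, mul_one,
        Matrix.scalar_apply, ← Matrix.smul_one_eq_diagonal]
      abel
    rw [h1, neg_mul, mul_assoc, h, mul_one]
  have hfac : Matrix.scalar (Fin N) z - G U v t = (Matrix.scalar (Fin N) z - U) *
      (1 + Matrix.vecMulVec (-((1 - (t : ℂ)) • R.mulVec v.ofLp)) (star v.ofLp)) := by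
    rw [Matrix.neg_vecMulVec, Matrix.smul_vecMulVec, ← Matrix.mul_vecMulVec, mul_add, mul_one,
      mul_neg, mul_smul_comm, ← mul_assoc, hUR, G, mul_sub, mul_one, mul_smul_comm, neg_mul,
      smul_neg]
    abel
  rw [Matrix.eval_charpoly, Matrix.eval_charpoly, hfac, Matrix.det_mul,
    Matrix.vecMulVec_eq Unit, Matrix.det_one_add_replicateCol_mul_replicateRow, dotProduct_neg,
    dotProduct_smul, smul_eq_mul, resolventForm, ← sub_eq_add_neg]

lemma eval_charpoly_ne_zero (hU : U ∈ Matrix.unitaryGroup (Fin N) ℂ) {z : ℂ} (hz : ‖z‖ < 1) :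
    U.charpoly.eval z ≠ 0 := by
  have hU' : star U ∈ Matrix.unitaryGroup (Fin N) ℂ := Unitary.star_mem hU
  have h1 : Matrix.scalar (Fin N) z - U = (-U) * (1 - z • star U) := by
    rw [neg_mul, mul_sub, mul_smul_comm, Matrix.mem_unitaryGroup_iff.1 hU, mul_one,
      Matrix.scalar_apply, ← Matrix.smul_one_eq_diagonal]
    abel
  rw [Matrix.eval_charpoly, h1]
  refine ((Matrix.isUnit_iff_isUnit_det _).1 (IsUnit.mul ?_ (isUnit_one_sub_smul hU' hz))).ne_zero
  exact (Unitary.isUnit_coe (U := ⟨U, hU⟩)).neg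

lemma differentiableAt_W2 (hU : U ∈ Matrix.unitaryGroup (Fin N) ℂ) {z : ℂ} (hz : ‖z‖ < 1) :
    DifferentiableAt ℂ (W2 U v) z := by
  have hU' : star U ∈ Matrix.unitaryGroup (Fin N) ℂ := Unitary.star_mem hU
  let ℓ : Matrix (Fin N) (Fin N) ℂ →ₗ[ℂ] ℂ :=
    { toFun := fun M => star v.ofLp ⬝ᵥ M.mulVec v.ofLp
      map_add' := fun A B => by rw [Matrix.add_mulVec, dotProduct_add]
      map_smul' := fun c A => by rw [Matrix.smul_mulVec, dotProduct_smul]; rfl }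
  have hinv : DifferentiableAt ℂ (fun z : ℂ => (1 - z • star U)⁻¹) z := by
    simp only [Matrix.nonsing_inv_eq_ringInverse]
    exact (differentiableAt_inverse (𝕜 := ℂ) (isUnit_one_sub_smul hU' hz)).comp z
      (f := fun z : ℂ => 1 - z • star U) (by fun_prop)
  have hsq : DifferentiableAt ℂ (fun z : ℂ => (z • star U) ^ 2) z := by fun_prop
  exact (LinearMap.toContinuousLinearMap ℓ).differentiableAt.comp z (hsq.mul hinv)

/-- The factor `I - (1 - t) v v^*` is a contraction: it lowers `‖X‖²` by `(1 - t²) |⟨v, X⟩|²`. -/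
lemma norm_le_one_of_mem_eigenvalues (hU : U ∈ Matrix.unitaryGroup (Fin N) ℂ) (hv : ‖v‖ = 1)
    {t : ℝ} (ht : |t| ≤ 1) {μ : ℂ} (hμ : μ ∈ eigenvalues (G U v t)) : ‖μ‖ ≤ 1 := by
  have hdet : (Matrix.scalar (Fin N) μ - G U v t).det = 0 := by
    rw [← Matrix.eval_charpoly]
    exact (Polynomial.mem_roots'.1 hμ).2
  obtain ⟨x, hx0, hx⟩ := Matrix.exists_mulVec_eq_zero_iff.2 hdet
  rw [Matrix.sub_mulVec, sub_eq_zero, Matrix.scalar_apply, ← Matrix.smul_one_eq_diagonal,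
    Matrix.smul_mulVec, Matrix.one_mulVec, G, ← Matrix.mulVec_mulVec, Matrix.sub_mulVec,
    Matrix.one_mulVec, Matrix.smul_mulVec, Matrix.vecMulVec_mulVec] at hx
  set X : EuclideanSpace ℂ (Fin N) := WithLp.toLp 2 x with hX
  have hinner : star v.ofLp ⬝ᵥ x = inner ℂ v X := by
    rw [EuclideanSpace.inner_eq_star_dotProduct, dotProduct_comm]
  rw [hinner] at hx
  have hx' : μ • X = U.toEuclideanLin (X - ((1 - t : ℝ) : ℂ) • inner ℂ v X • v) := by
    apply WithLp.ofLp_injective 2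
    rw [Matrix.ofLp_toLpLin, Matrix.toLin'_apply]
    simpa [hX] using hx
  have hnorm := congrArg norm hx'
  rw [toEuclideanLin_norm_of_mem_unitary hU, norm_smul] at hnorm
  have hXpos : 0 < ‖X‖ := by
    rw [norm_pos_iff]
    intro h
    apply hx0
    rw [hX] at h
    simpa using h
  have hsq : ‖X - ((1 - t : ℝ) : ℂ) • inner ℂ v X • v‖ ^ 2 ≤ ‖X‖ ^ 2 := by
    rw [norm_sub_sq (𝕜 := ℂ), inner_smul_right, inner_smul_right, norm_smul, norm_smul, hv,
      ← inner_conj_symm X v, Complex.mul_conj, Complex.normSq_eq_norm_sq, ← Complex.ofReal_mul]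
    simp only [RCLike.re_to_complex, Complex.ofReal_re, Complex.norm_real, Real.norm_eq_abs,
      mul_one, mul_pow, sq_abs]
    have := abs_le.1 ht
    have h1 : 0 ≤ (1 - t) * (1 + t) := by nlinarith
    nlinarith [mul_nonneg h1 (sq_nonneg ‖inner ℂ v X‖)]
  have hle := (pow_le_pow_iff_left₀ (norm_nonneg _) (norm_nonneg _) two_ne_zero).1 hsq
  rw [← hnorm] at hle
  exact (mul_le_iff_le_one_left hXpos).1 hle

end Deterministic

/-! ### The secular equation -/

variable {N : ℕ} {U : Matrix (Fin N) (Fin N) ℂ} {v : EuclideanSpace ℂ (Fin N)}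

lemma exactlyOneIn_of_unique {M : Matrix (Fin N) (Fin N) ℂ} {S T : Set ℂ} {z : ℂ} (hzS : z ∈ S)
    (hST : S ⊆ T) (hcount : (eigenvalues M).count z = 1)
    (huniq : ∀ μ ∈ eigenvalues M, μ ∈ T → μ = z) (hdisc : ∀ μ ∈ eigenvalues M, ‖μ‖ ≤ 1) :
    ExactlyOneIn M S T := by
  classical
  refine ⟨?_, fun μ hμ hμS => ⟨mem_closedBall_zero_iff.2 (hdisc μ hμ), fun hμT => hμS ?_⟩⟩
  · rw [← hcount, Multiset.count]
    refine Multiset.countP_congr rfl fun μ hμ => ?_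
    exact propext ⟨fun h => (huniq μ hμ (hST h)).symm, fun h => h ▸ hzS⟩
  · rw [huniq μ hμ hμT]
    exact hzS

/-- On the unit disc, the characteristic polynomial of `G(t)` is the one of `U`, which does not
vanish there, times the scalar secular equation. -/
lemma eval_charpoly_G_eq_mul (hU : U ∈ Matrix.unitaryGroup (Fin N) ℂ) (hv : ‖v‖ = 1)
    (hN : N ≠ 0) (hω : omega1 U v ≠ 0) {t : ℝ} (ht : t ≠ 1) {z : ℂ} (hz : ‖z‖ < 1) :
    (G U v t).charpoly.eval z = (U.charpoly.eval z * ((1 - t) * (omega1 U v / Real.sqrt N))) *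
      (zt U v t - (z + Real.sqrt N / omega1 U v * W2 U v z)) := by
  have hs : (Real.sqrt N : ℂ) ≠ 0 := by
    rw [Complex.ofReal_ne_zero, Real.sqrt_ne_zero']
    exact_mod_cast Nat.pos_of_ne_zero hN
  have ht' : (1 - t : ℂ) ≠ 0 := by
    rw [sub_ne_zero]
    exact_mod_cast ht.symm
  rw [eval_charpoly_G hU t hz, resolventForm_eq hU hv hN hz, zt]
  field_simp
  ring

lemma mem_eigenvalues_G_iff (hU : U ∈ Matrix.unitaryGroup (Fin N) ℂ) (hv : ‖v‖ = 1)
    (hN : N ≠ 0) (hω : omega1 U v ≠ 0) {t : ℝ} (ht : t ≠ 1) {z : ℂ} (hz : ‖z‖ < 1) :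
    z ∈ eigenvalues (G U v t) ↔ z + Real.sqrt N / omega1 U v * W2 U v z = zt U v t := by
  have hs : (Real.sqrt N : ℂ) ≠ 0 := by
    rw [Complex.ofReal_ne_zero, Real.sqrt_ne_zero']
    exact_mod_cast Nat.pos_of_ne_zero hN
  have ht' : (1 - t : ℂ) ≠ 0 := by
    rw [sub_ne_zero]
    exact_mod_cast ht.symm
  rw [eigenvalues, Polynomial.mem_roots (Matrix.charpoly_monic _).ne_zero, Polynomial.IsRoot,
    eval_charpoly_G_eq_mul hU hv hN hω ht hz, mul_eq_zero_iff_left, sub_eq_zero, eq_comm]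
  exact mul_ne_zero (eval_charpoly_ne_zero hU hz) (mul_ne_zero ht' (div_ne_zero hω hs))

lemma norm_zt (t : ℝ) :
    ‖zt U v t‖ = Real.sqrt N / ‖omega1 U v‖ * (|t| / |1 - t|) := by
  have : (1 - t : ℂ) = ((1 - t : ℝ) : ℂ) := by push_cast; rfl
  rw [zt, this]
  rw [norm_mul, norm_div, norm_div, Complex.norm_real, Complex.norm_real, Complex.norm_real,
    Real.norm_of_nonneg (Real.sqrt_nonneg _), Real.norm_eq_abs, Real.norm_eq_abs]

/-- The hypotheses of the deterministic part: `ω₁` is of order one and `W₂` is small, up to the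
factor `A`. -/
structure IsRegular (U : Matrix (Fin N) (Fin N) ℂ) (v : EuclideanSpace ℂ (Fin N)) (A : ℝ) :
    Prop where
  unitary : U ∈ Matrix.unitaryGroup (Fin N) ℂ
  norm_eq_one : ‖v‖ = 1
  four_le : 4 ≤ N
  one_le : 1 ≤ A
  le_sqrt : A ≤ Real.sqrt N
  inv_lt_omega1 : A⁻¹ < ‖omega1 U v‖
  omega1_lt : ‖omega1 U v‖ < A
  norm_W2_le : ∀ z, ‖z‖ < 1 - (N : ℝ)⁻¹ →
    ‖W2 U v z‖ ≤ A * (‖z‖ ^ 2 / (Real.sqrt N * (1 - ‖z‖)))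

/-! ### Deterministic estimates, with `A`, `B`, `C` standing for `N^η`, `N^ε`, `N^α` -/

namespace IsRegular

variable {A : ℝ}

lemma ne_zero (h : IsRegular U v A) : N ≠ 0 := by
  have := h.four_le
  omega

lemma pos (h : IsRegular U v A) : 0 < A := zero_lt_one.trans_le h.one_le

lemma sqrt_pos (h : IsRegular U v A) : 0 < Real.sqrt N := h.pos.trans_le h.le_sqrt

lemma omega1_pos (h : IsRegular U v A) : 0 < ‖omega1 U v‖ :=
  (inv_pos.2 h.pos).trans h.inv_lt_omega1

lemma omega1_ne_zero (h : IsRegular U v A) : omega1 U v ≠ 0 := norm_pos_iff.1 h.omega1_pos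

lemma inv_omega1_le (h : IsRegular U v A) : ‖omega1 U v‖⁻¹ ≤ A :=
  inv_le_of_inv_le₀ h.pos h.inv_lt_omega1.le

lemma norm_mul_W2_le (h : IsRegular U v A) {z : ℂ} (hz : ‖z‖ < 3 / 4) :
    ‖Real.sqrt N / omega1 U v * W2 U v z‖ ≤ 4 * A ^ 2 * ‖z‖ ^ 2 := by
  have hs := h.sqrt_pos
  have h4 : (4 : ℝ) ≤ N := by exact_mod_cast h.four_le
  have hN : (N : ℝ)⁻¹ ≤ 1 / 4 := by
    rw [one_div]
    exact inv_anti₀ (by norm_num) h4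
  have hW := h.norm_W2_le z (by linarith)
  rw [norm_mul, norm_div, Complex.norm_real, Real.norm_of_nonneg hs.le, div_eq_mul_inv]
  calc Real.sqrt N * ‖omega1 U v‖⁻¹ * ‖W2 U v z‖
      ≤ Real.sqrt N * A * (A * (‖z‖ ^ 2 / (Real.sqrt N * (1 - ‖z‖)))) := by
        gcongr
        · exact mul_nonneg hs.le h.pos.le
        · exact h.inv_omega1_le
    _ = A ^ 2 * ‖z‖ ^ 2 * (1 - ‖z‖)⁻¹ := by
        have : 1 - ‖z‖ ≠ 0 := by linarith
        field_simp
    _ ≤ A ^ 2 * ‖z‖ ^ 2 * 4 := by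
        gcongr
        exact inv_le_of_inv_le₀ (by norm_num) (by norm_num; linarith)
    _ = _ := by ring

/-- The bound on `W₂` extends to the whole unit disc. -/
lemma one_sub_mul_norm_W2_le (h : IsRegular U v A) {z : ℂ} (hz : ‖z‖ < 1) :
    (1 - ‖z‖) * ‖W2 U v z‖ ≤ 17 * (A / Real.sqrt N) := by
  have hs := h.sqrt_pos
  have hA := h.pos
  set a := A / Real.sqrt N with ha
  have ha0 : 0 < a := div_pos hA hs
  have ha1 : a ≤ 1 := (div_le_one hs).2 h.le_sqrt
  have h4 : (4 : ℝ) ≤ N := by exact_mod_cast h.four_le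
  have hNpos : (0 : ℝ) < N := by linarith
  have hN4 : (N : ℝ)⁻¹ ≤ 1 / 4 := by
    rw [one_div]
    exact inv_anti₀ (by norm_num) h4
  have hN0 : (0 : ℝ) < (N : ℝ)⁻¹ := inv_pos.2 hNpos
  have hNa : (N : ℝ)⁻¹ ≤ a := by
    have h1 : (1 : ℝ) ≤ Real.sqrt N := h.one_le.trans h.le_sqrt
    have h2 : (N : ℝ) = Real.sqrt N * Real.sqrt N := (Real.mul_self_sqrt hNpos.le).symm
    rw [ha, div_eq_mul_inv, h2, mul_inv, ← h2]
    have h3 : (Real.sqrt N)⁻¹ ≤ 1 := inv_le_one_of_one_le₀ h1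
    gcongr
    exact h3.trans h.one_le
  have hωa : ‖omega1 U v / Real.sqrt N‖ ≤ a := by
    rw [norm_div, Complex.norm_real, Real.norm_of_nonneg hs.le, ha]
    gcongr
    exact h.omega1_lt.le
  have hin : ∀ w : ℂ, ‖w‖ < 1 - (N : ℝ)⁻¹ → (1 - ‖w‖) * ‖W2 U v w‖ ≤ a := by
    intro w hw
    have h1 : 0 < 1 - ‖w‖ := by linarith
    calc (1 - ‖w‖) * ‖W2 U v w‖
        ≤ (1 - ‖w‖) * (A * (‖w‖ ^ 2 / (Real.sqrt N * (1 - ‖w‖)))) := by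
          gcongr
          exact h.norm_W2_le w hw
      _ = a * ‖w‖ ^ 2 := by rw [ha]; field_simp
      _ ≤ a * 1 := by
          gcongr
          exact pow_le_one₀ (norm_nonneg _) (by linarith)
      _ = a := mul_one a
  rcases lt_or_ge ‖z‖ (1 - (N : ℝ)⁻¹) with hlt | hge
  · linarith [hin z hlt]
  · have hz0 : 0 < ‖z‖ := by linarith
    -- Compare with the point of modulus `1 - 2/N` on the same radius, where regularity applies.
    set ρ : ℝ := (1 - 2 * (N : ℝ)⁻¹) / ‖z‖ with hρ
    have hρ0 : 0 ≤ ρ := div_nonneg (by linarith) hz0.le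
    have hρ1 : ρ ≤ 1 := (div_le_one hz0).2 (by linarith)
    have hz₀ : ‖(ρ : ℂ) * z‖ = 1 - 2 * (N : ℝ)⁻¹ := by
      rw [norm_mul, Complex.norm_real, Real.norm_of_nonneg hρ0, hρ, div_mul_cancel₀ _ hz0.ne']
    have hrad : ‖z - (ρ : ℂ) * z‖ = ‖z‖ - ‖(ρ : ℂ) * z‖ := by
      have h1 : z - (ρ : ℂ) * z = ((1 - ρ : ℝ) : ℂ) * z := by push_cast; ring
      rw [h1, norm_mul, norm_mul, Complex.norm_real, Complex.norm_real, Real.norm_of_nonneg hρ0,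
        Real.norm_of_nonneg (by linarith)]
      ring
    have hmono := one_sub_mul_norm_resolventForm_le (v := v) h.unitary (z := z)
      (z₀ := (ρ : ℂ) * z) (by rw [hz₀]; linarith) hz hrad
    have hin₀ := hin ((ρ : ℂ) * z) (by rw [hz₀]; linarith)
    rw [resolventForm_eq h.unitary h.norm_eq_one h.ne_zero hz,
      resolventForm_eq h.unitary h.norm_eq_one h.ne_zero (by rw [hz₀]; linarith)] at hmono
    set Q := omega1 U v / (Real.sqrt N : ℂ)
    have hlin : ∀ w : ℂ, ‖w‖ ≤ 1 → ‖1 + w * Q‖ ≤ 2 := by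
      intro w hw
      calc ‖1 + w * Q‖ ≤ ‖(1 : ℂ)‖ + ‖w * Q‖ := norm_add_le _ _
        _ ≤ 1 + 1 * a := by
            rw [norm_one, norm_mul]
            gcongr
        _ ≤ 2 := by linarith
    have hup : ‖1 + (ρ : ℂ) * z * Q + W2 U v (ρ * z)‖ ≤ 2 + ‖W2 U v (ρ * z)‖ :=
      (norm_add_le _ _).trans (add_le_add_left (hlin _ (by rw [hz₀]; linarith)) _)
    have hlow : ‖W2 U v z‖ ≤ ‖1 + z * Q + W2 U v z‖ + 2 := by
      calc ‖W2 U v z‖ = ‖(1 + z * Q + W2 U v z) - (1 + z * Q)‖ := by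
            rw [add_sub_cancel_left]
        _ ≤ _ := norm_sub_le _ _
        _ ≤ _ := by gcongr; exact hlin z hz.le
    rw [hz₀] at hmono hin₀
    have e1 : (1 - (1 - 2 * (N : ℝ)⁻¹)) * ‖1 + (ρ : ℂ) * z * Q + W2 U v (ρ * z)‖
        ≤ (1 - (1 - 2 * (N : ℝ)⁻¹)) * (2 + ‖W2 U v (ρ * z)‖) :=
      mul_le_mul_of_nonneg_left hup (by linarith)
    have e2 : (1 - ‖z‖) * ‖W2 U v z‖ ≤ (1 - ‖z‖) * (‖1 + z * Q + W2 U v z‖ + 2) :=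
      mul_le_mul_of_nonneg_left hlow (by linarith)
    -- The constant is `12/N + 3a` from the comparison, plus `2/N` from the linear terms, and `1/N ≤
    -- a`.
    linarith

lemma exists_unique_eigenvalue_near_zero (h : IsRegular U v A) {R t : ℝ} (hR : 0 < R)
    (hR4 : R ≤ 1 / 4) (hAR : 4 * A ^ 2 * R ≤ 1 / 100) (ht : t ≠ 1)
    (hzt : ‖zt U v t‖ ≤ R / 100) :
    ∃ z, ‖z‖ < R ∧ ‖z - zt U v t‖ ≤ 16 * A ^ 2 * ‖zt U v t‖ ^ 2 ∧
      (eigenvalues (G U v t)).count z = 1 ∧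
      ∀ μ ∈ eigenvalues (G U v t), ‖μ‖ < R → μ = z := by
  have hA := h.pos
  have hs : (Real.sqrt N : ℂ) ≠ 0 := Complex.ofReal_ne_zero.2 h.sqrt_pos.ne'
  have ht' : (1 - t : ℂ) ≠ 0 := by
    rw [sub_ne_zero]
    exact_mod_cast ht.symm
  have hW : ∀ z : ℂ, ‖z‖ < 1 → DifferentiableAt ℂ
      (fun z => Real.sqrt N / omega1 U v * W2 U v z) z := fun z hz =>
    (differentiableAt_W2 h.unitary hz).const_mul _
  obtain ⟨z, hzR, hz, hza, hder, huniq⟩ := exists_unique_simple_solution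
    (h := fun z => Real.sqrt N / omega1 U v * W2 U v z) (L := 4 * A ^ 2) (by positivity) hR hR4 hAR
    (fun z hz => (hW z (by rw [mem_ball_zero_iff] at hz; linarith)).differentiableWithinAt)
    (fun z hz => h.norm_mul_W2_le hz) hzt
  have hz1 : ‖z‖ < 1 := by linarith
  refine ⟨z, hzR, by linarith, ?_, fun μ hμ hμR => huniq μ hμR ?_⟩
  · refine count_roots_eq_one_of_eventually_eq (Matrix.charpoly_monic _).ne_zero
      (q := fun w => U.charpoly.eval w * ((1 - t) * (omega1 U v / Real.sqrt N)))
      (F := fun w => zt U v t - (w + Real.sqrt N / omega1 U v * W2 U v w))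
      (U.charpoly.differentiable.differentiableAt.mul_const _)
      ((differentiableAt_id.add (hW z hz1)).const_sub _) ?_
      (mul_ne_zero (eval_charpoly_ne_zero h.unitary hz1)
        (mul_ne_zero ht' (div_ne_zero h.omega1_ne_zero hs))) (sub_eq_zero.2 hz.symm) ?_
    · filter_upwards [Metric.isOpen_ball.mem_nhds (mem_ball_zero_iff.2 hz1)] with w hw
      exact eval_charpoly_G_eq_mul h.unitary h.norm_eq_one h.ne_zero h.omega1_ne_zero ht
        (mem_ball_zero_iff.1 hw)
    · rw [deriv_const_sub, deriv_fun_add differentiableAt_fun_id (hW z hz1), deriv_id'']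
      exact neg_ne_zero.2 hder
  · exact (mem_eigenvalues_G_iff h.unitary h.norm_eq_one h.ne_zero h.omega1_ne_zero ht
      (by linarith)).1 hμ

lemma exactlyOneIn_ball (h : IsRegular U v A) {B C t : ℝ} (hB : 400 * A ^ 2 ≤ B)
    (hC : 200 * (A * B) ≤ C) (ht0 : t ≠ 0) (ht : |t| < (Real.sqrt N)⁻¹ * C⁻¹) :
    ExactlyOneIn (G U v t) (Metric.ball (zt U v t) (‖zt U v t‖ ^ 2 * B))
      (Metric.ball 0 B⁻¹) := by
  have hA := h.pos
  have hA1 := h.one_le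
  have hs := h.sqrt_pos
  have hB400 : 400 ≤ B := by nlinarith
  have hB0 : 0 < B := by linarith
  have hAB : 400 ≤ A * B := by nlinarith
  have hC0 : 0 < C := by linarith
  have hth : |t| ≤ 1 / 2 := by
    have h1 : (Real.sqrt N)⁻¹ ≤ 1 := inv_le_one_of_one_le₀ (hA1.trans h.le_sqrt)
    have h2 : C⁻¹ ≤ 2⁻¹ := inv_anti₀ (by norm_num) (by linarith)
    have h3 : (Real.sqrt N)⁻¹ * C⁻¹ ≤ 1 * 2⁻¹ := by gcongr
    linarith
  have htb := abs_le.1 hth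
  have ht1 : t ≠ 1 := by linarith
  have hzt : ‖zt U v t‖ ≤ B⁻¹ / 100 := by
    rw [norm_zt, abs_of_nonneg (show 0 ≤ 1 - t by linarith)]
    calc Real.sqrt N / ‖omega1 U v‖ * (|t| / (1 - t))
        = Real.sqrt N * ‖omega1 U v‖⁻¹ * (|t| * (1 - t)⁻¹) := by
          rw [div_eq_mul_inv, div_eq_mul_inv]
      _ ≤ Real.sqrt N * A * (((Real.sqrt N)⁻¹ * C⁻¹) * 2) := by
          have h1 : (1 - t)⁻¹ ≤ 2 := inv_le_of_inv_le₀ (by norm_num) (by norm_num; linarith)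
          have h2 : 0 ≤ (1 - t)⁻¹ := inv_nonneg.2 (by linarith)
          gcongr
          exact h.inv_omega1_le
      _ = 2 * A / C := by field_simp
      _ ≤ 2 * A / (200 * (A * B)) := by gcongr
      _ = B⁻¹ / 100 := by field_simp; norm_num
  -- The open disc is nonempty only for `z_t ≠ 0`; this is why `t = 0` is treated separately.
  have hzt0 : 0 < ‖zt U v t‖ := by
    rw [norm_zt]
    have h1 : 0 < |t| := abs_pos.2 ht0
    have h2 : 0 < |1 - t| := abs_pos.2 (by linarith)
    have h3 := h.omega1_pos
    positivity
  have hR4 : B⁻¹ ≤ 1 / 4 := by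
    rw [one_div]
    exact inv_anti₀ (by norm_num) (by linarith)
  have hAR : 4 * A ^ 2 * B⁻¹ ≤ 1 / 100 := by
    rw [← div_eq_mul_inv, div_le_iff₀ hB0]
    linarith
  obtain ⟨z, -, hz, hcount, huniq⟩ :=
    h.exists_unique_eigenvalue_near_zero (inv_pos.2 hB0) hR4 hAR ht1 hzt
  refine exactlyOneIn_of_unique ?_ ?_ hcount
    (fun μ hμ hμT => huniq μ hμ (mem_ball_zero_iff.1 hμT))
    (fun μ hμ => norm_le_one_of_mem_eigenvalues h.unitary h.norm_eq_one (by linarith) hμ)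
  · rw [mem_ball_iff_norm]
    refine hz.trans_lt ?_
    rw [mul_comm]
    gcongr
    nlinarith
  · refine Metric.ball_subset_ball' ?_
    rw [dist_zero_right]
    have h1 : ‖zt U v t‖ ^ 2 * B ≤ (B⁻¹ / 100) ^ 2 * B := by gcongr
    have h2 : (B⁻¹ / 100) ^ 2 * B = B⁻¹ / 10000 := by field_simp; norm_num
    have h3 := inv_pos.2 hB0
    linarith

lemma exactlyOneIn_zero (h : IsRegular U v A) {B : ℝ} (hB : 400 * A ^ 2 ≤ B) :
    ExactlyOneIn (G U v 0) {0} (Metric.ball 0 B⁻¹) := by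
  have hA1 := h.one_le
  have hB0 : 0 < B := by nlinarith
  have hB400 : 400 ≤ B := by nlinarith
  have hzt : zt U v 0 = 0 := by simp [zt]
  have hR4 : B⁻¹ ≤ 1 / 4 := by
    rw [one_div]
    exact inv_anti₀ (by norm_num) (by linarith)
  have hAR : 4 * A ^ 2 * B⁻¹ ≤ 1 / 100 := by
    rw [← div_eq_mul_inv, div_le_iff₀ hB0]
    linarith
  obtain ⟨z, -, hz, hcount, huniq⟩ :=
    h.exists_unique_eigenvalue_near_zero (t := 0) (inv_pos.2 hB0) hR4 hAR zero_ne_one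
      (by rw [hzt, norm_zero]; positivity)
  have hz0 : z = 0 := by simpa [hzt] using hz
  subst hz0
  refine exactlyOneIn_of_unique (Set.mem_singleton _) ?_ hcount
    (fun μ hμ hμT => huniq μ hμ (mem_ball_zero_iff.1 hμT))
    (fun μ hμ => norm_le_one_of_mem_eigenvalues h.unitary h.norm_eq_one (by simp) hμ)
  simpa using hB0

lemma mem_annulus_of_supercritical (h : IsRegular U v A) {B C t : ℝ} (hB : 400 * A ^ 2 ≤ B)
    (hC : 200 * (A * B) ≤ C) (ht1 : |t| < 1) (ht : (Real.sqrt N)⁻¹ * C < |t|) {μ : ℂ}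
    (hμ : μ ∈ eigenvalues (G U v t)) :
    μ ∈ Metric.closedBall (0 : ℂ) 1 \ Metric.ball 0 (1 - ‖zt U v t‖⁻¹ * B) := by
  have hA := h.pos
  have hA1 := h.one_le
  have hs := h.sqrt_pos
  have hB400 : 400 ≤ B := by nlinarith
  have hB0 : 0 < B := by linarith
  have hC0 : 0 < C := by nlinarith
  have htb := abs_lt.1 ht1
  have h1t : 0 < 1 - t := by linarith
  -- This absorbs the `1` in `|z_t| ≤ 1 + X` below, giving `|z_t| ≤ 2X` and `(1 - |μ|) |z_t| ≤ 34 A²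
  -- < B`.
  have hzt : 2 ≤ ‖zt U v t‖ := by
    rw [norm_zt, abs_of_pos h1t]
    calc (2 : ℝ) ≤ 100 * B := by linarith
      _ = 200 * (A * B) * A⁻¹ * 2⁻¹ := by field_simp; norm_num
      _ ≤ C * A⁻¹ * 2⁻¹ := by gcongr
      _ = Real.sqrt N / A * (((Real.sqrt N)⁻¹ * C) / 2) := by field_simp
      _ ≤ Real.sqrt N / ‖omega1 U v‖ * (|t| / (1 - t)) := by
          have h1 := h.omega1_lt.le
          have h2 := h.omega1_pos
          have h3 : 1 - t ≤ 2 := by linarith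
          gcongr
  have hzt0 : 0 < ‖zt U v t‖ := by linarith
  refine ⟨mem_closedBall_zero_iff.2
    (norm_le_one_of_mem_eigenvalues h.unitary h.norm_eq_one ht1.le hμ), fun hball => ?_⟩
  rw [mem_ball_zero_iff] at hball
  have hpos : 0 < ‖zt U v t‖⁻¹ * B := by positivity
  have hμ1 : ‖μ‖ < 1 := by linarith
  have h1μ : 0 < 1 - ‖μ‖ := by linarith
  have heq := (mem_eigenvalues_G_iff h.unitary h.norm_eq_one h.ne_zero h.omega1_ne_zero
    (by linarith : t ≠ 1) hμ1).1 hμ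
  have hW : (1 - ‖μ‖) * ‖Real.sqrt N / omega1 U v * W2 U v μ‖ ≤ 17 * A ^ 2 := by
    rw [norm_mul, norm_div, Complex.norm_real, Real.norm_of_nonneg hs.le]
    calc (1 - ‖μ‖) * (Real.sqrt N / ‖omega1 U v‖ * ‖W2 U v μ‖)
        = Real.sqrt N * ‖omega1 U v‖⁻¹ * ((1 - ‖μ‖) * ‖W2 U v μ‖) := by
          rw [div_eq_mul_inv]; ring
      _ ≤ Real.sqrt N * A * (17 * (A / Real.sqrt N)) := by
          refine mul_le_mul ?_ (h.one_sub_mul_norm_W2_le hμ1) (by positivity) (by positivity)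
          gcongr
          exact h.inv_omega1_le
      _ = 17 * A ^ 2 := by field_simp
  have htri : ‖zt U v t‖ ≤ 1 + ‖Real.sqrt N / omega1 U v * W2 U v μ‖ := by
    rw [← heq]
    exact (norm_add_le _ _).trans (by gcongr)
  set X := ‖Real.sqrt N / omega1 U v * W2 U v μ‖
  have hBz : B < (1 - ‖μ‖) * ‖zt U v t‖ := by
    have h1 : ‖zt U v t‖⁻¹ * B < 1 - ‖μ‖ := by linarith
    rwa [inv_mul_lt_iff₀ hzt0, mul_comm] at h1
  have h1 : (1 - ‖μ‖) * ‖zt U v t‖ ≤ (1 - ‖μ‖) * (2 * X) := by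
    gcongr
    linarith
  nlinarith

end IsRegular

/-! ### Calculus of high-probability events -/

section Probability

variable {Ω : ℕ → Type*} [∀ N, MeasurableSpace (Ω N)] {P : ∀ N, Measure (Ω N)}
  {E F : ∀ N, Set (Ω N)}

lemma WOP.whp (h : WOP P E) : WHP P E := by
  have h1 : Tendsto (fun N : ℕ => ENNReal.ofReal ((N : ℝ) ^ (-1 : ℝ))) atTop (𝓝 0) := by
    rw [← ENNReal.ofReal_zero]
    exact ENNReal.tendsto_ofReal
      ((tendsto_rpow_neg_atTop one_pos).comp tendsto_natCast_atTop_atTop)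
  exact tendsto_of_tendsto_of_tendsto_of_le_of_le' tendsto_const_nhds h1
    (Eventually.of_forall fun _ => zero_le)
    ((h 1 one_pos).mono fun _ h => h.le)

lemma WHP.inter (hE : WHP P E) (hF : WHP P F) : WHP P (fun N => E N ∩ F N) := by
  have h := hE.add hF
  rw [add_zero] at h
  refine tendsto_of_tendsto_of_tendsto_of_le_of_le tendsto_const_nhds h (fun _ => zero_le)
    fun N => ?_
  simp only [Set.compl_inter]
  exact measure_union_le _ _

lemma WHP.mono (hE : WHP P E) (h : ∀ᶠ N in atTop, E N ⊆ F N) : WHP P F :=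
  tendsto_of_tendsto_of_tendsto_of_le_of_le' tendsto_const_nhds hE
    (Eventually.of_forall fun _ => zero_le)
    (h.mono fun _ h => measure_mono (Set.compl_subset_compl.2 h))

end Probability

lemma eventually_const_mul_rpow_le (c : ℝ) {a b : ℝ} (hab : a < b) :
    ∀ᶠ N : ℕ in atTop, c * (N : ℝ) ^ a ≤ (N : ℝ) ^ b := by
  have h1 : Tendsto (fun N : ℕ => (N : ℝ) ^ (b - a)) atTop atTop :=
    (tendsto_rpow_atTop (sub_pos.2 hab)).comp tendsto_natCast_atTop_atTop
  filter_upwards [h1.eventually_ge_atTop c, eventually_gt_atTop 0] with N hN hpos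
  have hpos' : (0 : ℝ) < N := by exact_mod_cast hpos
  calc c * (N : ℝ) ^ a ≤ (N : ℝ) ^ (b - a) * (N : ℝ) ^ a := by gcongr
    _ = (N : ℝ) ^ b := by rw [← Real.rpow_add hpos', sub_add_cancel]

end UAModel
-- The main theorem
theorem mainTheorem3 {Ω : ℕ → Type*} [∀ N, MeasurableSpace (Ω N)]
    (P : ∀ N, Measure (Ω N)) [∀ N, IsProbabilityMeasure (P N)]
    (U : ∀ N, Ω N → Matrix (Fin N) (Fin N) ℂ)
    (v : ∀ N, Ω N → EuclideanSpace ℂ (Fin N))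
    (hU_meas : ∀ N i j, Measurable fun ω => U N ω i j)
    (hv_meas : ∀ N, Measurable (v N))
    (hU : ∀ N ω, U N ω ∈ Matrix.unitaryGroup (Fin N) ℂ)
    (hv : ∀ N, 1 ≤ N → ∀ ω, ‖v N ω‖ = 1)
    (hW2 : UAModel.RegularityW2 P U v)
    (hω1 : UAModel.RegularityOmega1 P U v)
    (α ε : ℝ) (hε : 0 < ε) (hα : ε < α) :
    UAModel.WHP P (fun N => {ω |
      -- sub-critical times; at `t = 0` the disc degenerates to its center `z_0 = 0`
      (∀ t : ℝ, t ≠ 0 → |t| < (N : ℝ) ^ (-(1 / 2 : ℝ) - α) →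
        UAModel.ExactlyOneIn (UAModel.G (U N ω) (v N ω) t)
          (Metric.ball (UAModel.zt (U N ω) (v N ω) t)
            (‖UAModel.zt (U N ω) (v N ω) t‖ ^ 2 * (N : ℝ) ^ ε))
          (Metric.ball 0 ((N : ℝ) ^ (-ε)))) ∧
      UAModel.ExactlyOneIn (UAModel.G (U N ω) (v N ω) 0) {0}
        (Metric.ball 0 ((N : ℝ) ^ (-ε))) ∧
      -- super-critical times
      (∀ t : ℝ, |t| < 1 → (N : ℝ) ^ (-(1 / 2 : ℝ) + α) < |t| →
        ∀ μ ∈ UAModel.eigenvalues (UAModel.G (U N ω) (v N ω) t),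
          μ ∈ Metric.closedBall (0 : ℂ) 1 \
            Metric.ball 0 (1 - ‖UAModel.zt (U N ω) (v N ω) t‖⁻¹ * (N : ℝ) ^ ε))}) := by
  -- The three upper bounds yield, for large `N`, `400 A² ≤ B`, `200 A B ≤ C` and `A ≤ √N`.
  obtain ⟨η, hη, h2η, hηα, hη2⟩ : ∃ η : ℝ, 0 < η ∧ 2 * η < ε ∧ η + ε < α ∧ η ≤ 1 / 2 := by
    refine ⟨min (min (ε / 3) ((α - ε) / 2)) (1 / 2), ?_, ?_, ?_, min_le_right _ _⟩
    · exact lt_min (lt_min (by linarith) (by linarith)) (by norm_num)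
    · have := (min_le_left (min (ε / 3) ((α - ε) / 2)) (1 / 2)).trans (min_le_left _ _)
      linarith
    · have := (min_le_left (min (ε / 3) ((α - ε) / 2)) (1 / 2)).trans (min_le_right _ _)
      linarith
  -- Taking `δ = 1` gives regularity up to `|z| < 1 - 1/N`, so the comparison near the circle costs
  -- only `O(1/N)`.
  refine ((hW2 1 one_pos η hη).whp.inter (hω1 η hη)).mono ?_
  filter_upwards [eventually_ge_atTop 4, UAModel.eventually_const_mul_rpow_le 400 h2η,
    UAModel.eventually_const_mul_rpow_le 200 hηα] with N hN hB hC
  rintro ω ⟨hWω, hω, hω'⟩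
  have hN1 : (1 : ℝ) ≤ N := by exact_mod_cast (by omega : 1 ≤ N)
  have hN0 : (0 : ℝ) < N := by linarith
  have hreg : UAModel.IsRegular (U N ω) (v N ω) ((N : ℝ) ^ η) :=
    { unitary := hU N ω
      norm_eq_one := hv N (by omega) ω
      four_le := hN
      one_le := Real.one_le_rpow hN1 hη.le
      le_sqrt := by
        rw [Real.sqrt_eq_rpow]
        exact Real.rpow_le_rpow_of_exponent_le hN1 hη2
      inv_lt_omega1 := by rwa [← Real.rpow_neg hN0.le]
      omega1_lt := hω'
      norm_W2_le := by
        intro z hz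
        have hNinv : (0 : ℝ) < (N : ℝ)⁻¹ := inv_pos.2 hN0
        have h1 := hWω z (by rwa [mem_ball_zero_iff, Real.rpow_neg_one])
        rwa [Complex.norm_real, Real.norm_of_nonneg (div_nonneg (sq_nonneg _)
          (mul_nonneg (Real.sqrt_nonneg _) (by linarith)))] at h1 }
  have hB' : 400 * ((N : ℝ) ^ η) ^ 2 ≤ (N : ℝ) ^ ε := by
    rwa [← Real.rpow_mul_natCast hN0.le, mul_comm η, Nat.cast_ofNat]
  have hC' : 200 * ((N : ℝ) ^ η * (N : ℝ) ^ ε) ≤ (N : ℝ) ^ α := by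
    rwa [← Real.rpow_add hN0]
  have hsqrt : (N : ℝ) ^ (-(1 / 2 : ℝ)) = (Real.sqrt N)⁻¹ := by
    rw [Real.rpow_neg hN0.le, Real.sqrt_eq_rpow]
  refine ⟨fun t ht0 ht => ?_, ?_, fun t ht1 ht μ hμ => ?_⟩
  · rw [Real.rpow_neg hN0.le ε]
    refine hreg.exactlyOneIn_ball hB' hC' ht0 ?_
    rwa [sub_eq_add_neg, Real.rpow_add hN0, hsqrt, Real.rpow_neg hN0.le α] at ht
  · rw [Real.rpow_neg hN0.le ε]
    exact hreg.exactlyOneIn_zero hB'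
  · refine hreg.mem_annulus_of_supercritical hB' hC' ht1 ?_ hμ
    rwa [Real.rpow_add hN0, hsqrt] at ht
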